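/- Throughout, rings have a $1$, modules are unital, and right $S$-modules over an $R$-algebra $S$ are regarded as $R$-modules via $R\to S$. For a ring $A$ and right $A$-modules $M,N$, let $\operatorname{spl}_A(M,N)\in\{0,1,2,\dots\}\cup\{\infty\}$ be the supremum of the nonnegative integers $t$ for which there is a split surjective $A$-linear map $M\to N^{\oplus t}$. The Krull dimension $\dim(Y)$ of a topological space $Y$ is the supremum of the lengths of chains of irreducible closed subsets of $Y$, with $\dim(\varnothing)=-\infty$; and $Y$ is Noetherian if its closed subsets satisfy the descending chain condition. **Theorem.** Let $R$ be a commutative ring, $S$ an $R$-algebra that is finitely generated as an $R$-module, $M$ a direct summand of a direct sum of finitely presented right $S$-modules, and $N$ a finitely presented right $S$-module. Let $Y:=\operatorname{Max}(R)\cap\operatorname{Supp}_R(N)$, the set of maximal ideals $\mathfrak m$ of $R$ with $N_{\mathfrak m}\neq 0$, with the subspace topology induced by the Zariski topology on $\operatorname{Spec}(R)$. Suppose that $Y$ is Noetherian and $\dim(Y)<\infty$. Then the following statements hold: 1. Let $t$ be a positive integer, and suppose that $\operatorname{spl}_{S_{\mathfrak m}}(M_{\mathfrak m},N_{\mathfrak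 m})\geq t+\dim(Y)$ for every $\mathfrak m\in Y$. Then $\operatorname{spl}_S(M,N)\geq t$. 2. $\operatorname{spl}_S(M,N)=\infty$ if and only if $\operatorname{spl}_{S_{\mathfrak m}}(M_{\mathfrak m},N_{\mathfrak m})=\infty$ for every $\mathfrak m\in Y$. 3. Suppose that $\operatorname{spl}_{S_{\mathfrak n}}(M_{\mathfrak n},N_{\mathfrak n})<\infty$ for some $\mathfrak n\in Y$. Then $$\operatorname{spl}_S(M,N)\geq \min\{\operatorname{spl}_{S_{\mathfrak m}}(M_{\mathfrak m},N_{\mathfrak m}):\mathfrak m\in Y\}-\dim(Y).$$ -/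

import Mathlib

open MulOpposite

noncomputable section

namespace RightModule

/-!
Right `S`-modules are modules over the opposite ring `Sᵐᵒᵖ`; the element `x * s` of a right module
is written `op s • x`.  The localization of a module `M` (or of an algebra `S`) at a prime `p` of
the commutative base ring `R` is `LocalizedModule p.asIdeal.primeCompl M`; for an `R`-algebra `S`
Mathlib makes it a ring.
-/

section Localization

variable {R : Type*} [CommRing R] (W : Submonoid R)
variable {S : Type*} [Ring S] [Algebra R S]
variable {M : Type*} [AddCommGroup M] [Module R M] [Module Sᵐᵒᵖ M] [IsScalarTower R Sᵐᵒᵖ M]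

theorem smul_smul_comm (r : R) (s : S) (x : M) : op s • r • x = r • op s • x := by
  rw [← algebraMap_smul Sᵐᵒᵖ r x, ← algebraMap_smul Sᵐᵒᵖ r (op s • x), smul_smul, smul_smul,
    Algebra.commutes]

theorem op_smul_smul (r : R) (s : S) (x : M) : op (r • s) • x = r • op s • x := by
  rw [op_smul, smul_assoc]

/-- The right action of `W⁻¹S` on `W⁻¹M`: `(x / v) * (s / u) = (x * s) / (u v)`. -/
instance localizedSMul : SMul (LocalizedModule W S)ᵐᵒᵖ (LocalizedModule W M) where
  smul a y :=
    LocalizedModule.liftOn a.unop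
      (fun b => LocalizedModule.liftOn y
        (fun x => LocalizedModule.mk (op b.1 • x.1) (b.2 * x.2))
        (by
          rintro ⟨x, v⟩ ⟨x', v'⟩ ⟨w, hw⟩
          rw [LocalizedModule.mk_eq]
          refine ⟨w, ?_⟩
          have h := congrArg (fun z => (b.2 : R) • op b.1 • z) hw
          simp only [Submonoid.smul_def, smul_smul_comm, mul_smul] at h ⊢
          rw [smul_comm (w : R) (b.2 : R), smul_comm (w : R) (b.2 : R)]
          exact h))
      (by
        rintro ⟨s, u⟩ ⟨s', u'⟩ ⟨w, hw⟩
        induction y with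
        | h x v =>
          simp only [LocalizedModule.liftOn_mk]
          rw [LocalizedModule.mk_eq]
          refine ⟨w, ?_⟩
          have h := congrArg (fun z => (v : R) • op z • x) hw
          simp only [Submonoid.smul_def, op_smul_smul, mul_smul] at h ⊢
          rw [smul_comm (u' : R) (v : R), smul_comm (u : R) (v : R), smul_comm (w : R) (v : R),
            smul_comm (w : R) (v : R)]
          exact h)

theorem op_mk_smul_mk (s : S) (u : W) (x : M) (v : W) :
    op (LocalizedModule.mk s u) • LocalizedModule.mk x v
      = LocalizedModule.mk (op s • x) (u * v) := by
  change LocalizedModule.liftOn (LocalizedModule.mk s u) _ _ = _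
  rw [LocalizedModule.liftOn_mk, LocalizedModule.liftOn_mk]

/-- `W⁻¹M` is a right module over `W⁻¹S`. -/
instance localizedModule : Module (LocalizedModule W S)ᵐᵒᵖ (LocalizedModule W M) where
  one_smul y := by
    induction y with
    | h x v =>
      have h1 : (1 : (LocalizedModule W S)ᵐᵒᵖ) = op (LocalizedModule.mk (1 : S) (1 : W)) := by
        rw [← op_one, OreLocalization.one_def]
      rw [h1, op_mk_smul_mk, op_one, one_smul, one_mul]
  mul_smul a b y := by
    induction a using MulOpposite.rec' with | _ a => _
    induction b using MulOpposite.rec' with | _ b => _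
    induction a with
    | h s u =>
      induction b with
      | h s' u' =>
        induction y with
        | h x v =>
          rw [← op_mul, LocalizedModule.mk_mul_mk]
          simp only [op_mk_smul_mk]
          rw [op_mul, mul_smul, mul_comm u' u, mul_assoc]
  smul_zero a := by
    induction a using MulOpposite.rec' with | _ a => _
    induction a with
    | h s u =>
      rw [← LocalizedModule.zero_mk (1 : W), op_mk_smul_mk, smul_zero, LocalizedModule.zero_mk,
        LocalizedModule.zero_mk]
  smul_add a y z := by
    induction a using MulOpposite.rec' with | _ a => _
    induction a with
    | h s u =>
      induction y with
      | h x v =>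
        induction z with
        | h x' v' =>
          simp only [LocalizedModule.mk_add_mk, op_mk_smul_mk]
          rw [LocalizedModule.mk_eq]
          refine ⟨1, ?_⟩
          simp only [Submonoid.smul_def, Submonoid.coe_mul, smul_smul_comm, smul_add, smul_smul,
            Submonoid.coe_one]
          congr 2 <;> ring
  add_smul a b y := by
    induction a using MulOpposite.rec' with | _ a => _
    induction b using MulOpposite.rec' with | _ b => _
    induction a with
    | h s u =>
      induction b with
      | h s' u' =>
        induction y with
        | h x v =>
          rw [← op_add]
          simp only [LocalizedModule.mk_add_mk, op_mk_smul_mk]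
          rw [LocalizedModule.mk_eq]
          refine ⟨1, ?_⟩
          simp only [Submonoid.smul_def, Submonoid.coe_mul, op_add, add_smul, op_smul_smul,
            smul_add, smul_smul, Submonoid.coe_one]
          congr 2 <;> ring
  zero_smul y := by
    induction y with
    | h x v =>
      rw [← op_zero, ← LocalizedModule.zero_mk (1 : W), op_mk_smul_mk, op_zero, zero_smul,
        LocalizedModule.zero_mk]

end Localization

section Capacity

/-- A linear map is split surjective if it has a linear right inverse. -/
def IsSplitSurjective {A : Type*} [Ring A] {M L : Type*} [AddCommGroup M] [AddCommGroup L]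
    [Module A M] [Module A L] (f : M →ₗ[A] L) : Prop :=
  ∃ g : L →ₗ[A] M, f ∘ₗ g = LinearMap.id

/-- The global splitting capacity of the right `S`-module `M` with respect to the right `S`-module
`N`: the supremum (possibly `⊤`) of the `t : ℕ` for which there is a split surjective `S`-linear map
from `M` to the direct sum of `t` copies of `N`. -/
def splittingCapacity (S : Type*) [Ring S] (M N : Type*) [AddCommGroup M] [AddCommGroup N]
    [Module Sᵐᵒᵖ M] [Module Sᵐᵒᵖ N] : ℕ∞ :=
  ⨆ (t : ℕ) (_ : ∃ f : M →ₗ[Sᵐᵒᵖ] (Fin t → N), IsSplitSurjective f), (t : ℕ∞)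

variable {R : Type*} [CommRing R]

/-- The local splitting capacity at a prime `p` of `R`: the splitting capacity of the right
`S_p`-module `M_p` with respect to the right `S_p`-module `N_p`. -/
def localSplittingCapacity (S : Type*) [Ring S] [Algebra R S]
    (M N : Type*) [AddCommGroup M] [AddCommGroup N] [Module R M] [Module R N]
    [Module Sᵐᵒᵖ M] [Module Sᵐᵒᵖ N] [IsScalarTower R Sᵐᵒᵖ M] [IsScalarTower R Sᵐᵒᵖ N]
    (p : PrimeSpectrum R) : ℕ∞ :=
  splittingCapacity (LocalizedModule p.asIdeal.primeCompl S)
    (LocalizedModule p.asIdeal.primeCompl M) (LocalizedModule p.asIdeal.primeCompl N)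

/-- The set of maximal ideals of `R` in the support of `N`, a subset of `Spec R`.  As a type it
carries the subspace topology induced by the Zariski topology. -/
def maxSupport (R : Type*) [CommRing R] (N : Type*) [AddCommGroup N] [Module R N] :
    Set (PrimeSpectrum R) :=
  {m | m.asIdeal.IsMaximal} ∩ Module.support R N

end Capacity

end RightModule

end

/-! This is a general-position argument in the style of Serre and Bass, run on maps `M → N^n`. The
quantity controlled is the deficiency of such a map at a maximal ideal `m`: the number of extra
copies of `N` in the source that make it split surjective modulo `m`. By Cayley–Hamilton, a
splitting modulo `m` becomes a splitting up to a scalar outside `m`. Hence bounds on the deficiency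
are open conditions, and deficiency 0 at every point of `Y` yields a global splitting
(`exists_comp_eq_id_of_forall_isMaximal`).

Put `w = t + dim Y`. Splittings of localizations onto `N^w` are defined globally up to denominators
(`exists_comp_eq_smul_of_localized`), and by compactness of `Y` finitely many of them combine into
one map `M → N^(w+k)` of deficiency at most `k` on `Y`. Copies of `N` in the target are then removed
one at a time by shears. The endomorphisms of `N` induce on `N/mN` an Artinian ring, which has
stable range one. Therefore, at a given `m`, a suitable shear lowers a positive deficiency along
with the number of copies (`LinearMap.DeficientAt.exists_coprod_comp`); an arbitrary shear never
raises it. The Chinese remainder theorem handles finitely many `m` at once.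

The invariant is that every irreducible closed `X` in `Y` contains a point where the map to `N^n`
has deficiency at most `n - (dim X + t)`. Finitely many test points suffice to keep it
(`TopologicalSpace.NoetherianSpace.exists_finite_inter_nonempty`), and for `n = t` it says that the
deficiency vanishes on `Y`. The last two statements follow from the first and from the fact that
capacities do not decrease under localization. -/

/-! ### Stable range one for Artinian rings -/

/-- Bass's condition that a ring have stable range one, for right ideals. -/
def HasStableRangeOne (E : Type*) [Ring E] : Prop :=
  ∀ a y b : E, a * y + b = 1 → ∃ z : E, IsUnit (a + b * z)

namespace HasStableRangeOne

theorem of_ringEquiv {E E' : Type*} [Ring E] [Ring E'] (e : E ≃+* E')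
    (h : HasStableRangeOne E') : HasStableRangeOne E := by
  intro a y b hab
  obtain ⟨z, hz⟩ := h (e a) (e y) (e b) (by rw [← map_mul, ← map_add, hab, map_one])
  refine ⟨e.symm z, ?_⟩
  have := hz.map e.symm
  simpa using this

theorem pi {κ : Type*} {E : κ → Type*} [∀ i, Ring (E i)] (h : ∀ i, HasStableRangeOne (E i)) :
    HasStableRangeOne (Π i, E i) := by
  intro a y b hab
  choose z hz using fun i ↦ h i (a i) (y i) (b i) (congrFun hab i)
  exact ⟨z, Pi.isUnit_iff.mpr hz⟩

end HasStableRangeOne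

/-- The stable range condition for left ideals in the endomorphism ring of a finite-dimensional
vector space. -/
theorem LinearMap.exists_add_comp_injective {D V : Type*} [DivisionRing D] [AddCommGroup V]
    [Module D V] [FiniteDimensional D V] (a y b : V →ₗ[D] V)
    (h : y ∘ₗ a + b = LinearMap.id) :
    ∃ z : V →ₗ[D] V, Function.Injective (a + z ∘ₗ b) := by
  obtain ⟨C, hC⟩ := Submodule.exists_isCompl (LinearMap.range a)
  have hfin : Module.finrank D (LinearMap.ker a) = Module.finrank D C := by
    have h1 := LinearMap.finrank_range_add_finrank_ker a
    have h2 := Submodule.finrank_add_eq_of_isCompl hC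
    omega
  let θ : LinearMap.ker a ≃ₗ[D] C := LinearEquiv.ofFinrankEq _ _ hfin
  have hb : LinearMap.ker (b ∘ₗ (LinearMap.ker a).subtype) = ⊥ := by
    rw [LinearMap.ker_eq_bot']
    rintro ⟨x, hx⟩ hbx
    have h1 := LinearMap.congr_fun h x
    rw [LinearMap.mem_ker] at hx
    simp only [LinearMap.comp_apply, Submodule.subtype_apply] at hbx
    simp only [LinearMap.add_apply, LinearMap.comp_apply, hx, hbx, map_zero, add_zero,
      LinearMap.id_apply] at h1
    exact Subtype.ext h1.symm
  obtain ⟨l, hl⟩ := LinearMap.exists_leftInverse_of_injective _ hb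
  -- This `z` carries `b (ker a)` isomorphically onto a complement of the range of `a`, so `a x` and
  -- `z (b x)` cannot cancel unless both vanish.
  refine ⟨C.subtype ∘ₗ θ.toLinearMap ∘ₗ l, (injective_iff_map_eq_zero _).mpr fun x hx ↦ ?_⟩
  simp only [LinearMap.add_apply, LinearMap.comp_apply, Submodule.subtype_apply,
    LinearEquiv.coe_coe] at hx
  have hdis := Submodule.disjoint_def.mp hC.disjoint
  have hax : a x = 0 := by
    refine hdis _ (LinearMap.mem_range_self a x) ?_
    rw [eq_neg_of_add_eq_zero_left hx]
    exact C.neg_mem (θ (l (b x))).2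
  rw [hax, zero_add] at hx
  have hlx := LinearMap.congr_fun hl ⟨x, hax⟩
  simp only [LinearMap.comp_apply, Submodule.subtype_apply, LinearMap.id_apply] at hlx
  have : θ (l (b x)) = 0 := Subtype.ext hx
  rw [hlx, LinearEquiv.map_eq_zero_iff] at this
  exact congrArg Subtype.val this

namespace HasStableRangeOne

theorem matrix (D : Type*) [DivisionRing D] (n : Type*) [Fintype n] [DecidableEq n] :
    HasStableRangeOne (Matrix n n D) := by
  intro a y b hab
  -- Matrices act on row vectors, which reverses products and exchanges the conditions for left and
  -- right ideals.
  let L := Matrix.toLinearMapRight' (R := D) (m := n) (n := n)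
  obtain ⟨z, hz⟩ := LinearMap.exists_add_comp_injective (L a) (L y) (L b) (by
    rw [← Matrix.toLinearMapRight'_mul, ← map_add, hab, Matrix.toLinearMapRight'_one])
  refine ⟨L.symm z, ?_⟩
  have hL : L (a + b * L.symm z) = L a + z ∘ₗ L b := by
    rw [map_add, Matrix.toLinearMapRight'_mul]
    congr 2
    exact L.apply_symm_apply z
  let e := LinearEquiv.ofInjectiveEndo _ hz
  have he : L (L.symm e.symm.toLinearMap) = e.symm.toLinearMap := L.apply_symm_apply _
  refine IsUnit.of_mul_eq_one (L.symm e.symm.toLinearMap) (L.injective ?_)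
  rw [Matrix.toLinearMapRight'_mul, Matrix.toLinearMapRight'_one]
  refine LinearMap.ext fun x ↦ ?_
  rw [LinearMap.comp_apply, hL]
  refine (congrArg (L (L.symm e.symm.toLinearMap)) (?_ : _ = e x)).trans ?_
  · rfl
  · rw [he]; exact e.symm_apply_apply x

theorem of_isSemisimpleRing (E : Type*) [Ring E] [IsSemisimpleRing E] : HasStableRangeOne E := by
  obtain ⟨n, D, d, _, _, ⟨e⟩⟩ := IsSemisimpleRing.exists_ringEquiv_pi_matrix_divisionRing E
  exact .of_ringEquiv e (.pi fun i ↦ matrix (D i) (Fin (d i)))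

/-- The Jacobson radical is nilpotent with semisimple quotient, so an element invertible modulo it
is invertible. -/
theorem of_isArtinianRing (E : Type*) [Ring E] [IsArtinianRing E] : HasStableRangeOne E := by
  intro a y b hab
  let q := Ideal.Quotient.mk (Ring.jacobson E)
  obtain ⟨z, hz⟩ := of_isSemisimpleRing (E ⧸ Ring.jacobson E) (q a) (q y) (q b)
    (by rw [← map_mul, ← map_add, hab, map_one])
  obtain ⟨z, rfl⟩ := Ideal.Quotient.mk_surjective z
  obtain ⟨c, hc⟩ := hz.exists_right_inv
  obtain ⟨c, rfl⟩ := Ideal.Quotient.mk_surjective c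
  refine ⟨z, ?_⟩
  have hmem : 1 - (a + b * z) * c ∈ Ring.jacobson E := by
    rw [← Ideal.Quotient.eq_zero_iff_mem, map_sub, map_mul, map_add, map_mul, map_one]
    exact sub_eq_zero.mpr hc.symm
  obtain ⟨k, hk⟩ := IsSemiprimaryRing.isNilpotent (R := E)
  have hnil : IsNilpotent (1 - (a + b * z) * c) := by
    refine ⟨k, ?_⟩
    have := Ideal.pow_mem_pow hmem k
    rwa [hk] at this
  have hu := hnil.isUnit_one_sub
  rw [sub_sub_cancel] at hu
  obtain ⟨w, hw⟩ := hu.exists_right_inv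
  rw [mul_assoc] at hw
  exact IsUnit.of_mul_eq_one _ hw

end HasStableRangeOne

/-! ### Congruence of linear maps modulo an ideal of the base ring -/

section Congruence

variable {R : Type*} [CommRing R] {A : Type*} [Ring A]
variable {X : Type*} [AddCommGroup X] [Module A X]
variable {Y : Type*} [AddCommGroup Y] [Module R Y] [Module A Y]
variable {Z : Type*} [AddCommGroup Z] [Module R Z] [Module A Z]

/-- Two linear maps are congruent modulo an ideal `I` of the base ring if their difference takes
values in `I • ⊤`. -/
def LinearMap.CongrMod (I : Ideal R) (f g : X →ₗ[A] Y) : Prop :=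
  ∀ x, f x - g x ∈ I • (⊤ : Submodule R Y)

theorem LinearMap.map_mem_smul_top [Algebra R A] [IsScalarTower R A Y] [IsScalarTower R A Z]
    {I : Ideal R} (h : Y →ₗ[A] Z) {y : Y} (hy : y ∈ I • (⊤ : Submodule R Y)) :
    h y ∈ I • (⊤ : Submodule R Z) := by
  have h1 : (h.restrictScalars R) y ∈ (I • (⊤ : Submodule R Y)).map (h.restrictScalars R) :=
    Submodule.mem_map_of_mem hy
  rw [Submodule.map_smul''] at h1
  exact Submodule.smul_mono le_rfl le_top h1

namespace LinearMap.CongrMod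

variable {I : Ideal R}

theorem refl (I : Ideal R) (f : X →ₗ[A] Y) : CongrMod I f f := fun x ↦ by simp

theorem of_eq {f g : X →ₗ[A] Y} (h : f = g) : CongrMod I f g := h ▸ refl I f

theorem symm {f g : X →ₗ[A] Y} (h : CongrMod I f g) : CongrMod I g f := fun x ↦ by
  rw [← neg_sub]; exact Submodule.neg_mem _ (h x)

theorem trans {f g h : X →ₗ[A] Y} (h₁ : CongrMod I f g) (h₂ : CongrMod I g h) :
    CongrMod I f h := fun x ↦ by
  rw [← sub_add_sub_cancel _ (g x)]; exact Submodule.add_mem _ (h₁ x) (h₂ x)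

theorem add {f g f' g' : X →ₗ[A] Y} (h : CongrMod I f g) (h' : CongrMod I f' g') :
    CongrMod I (f + f') (g + g') := fun x ↦ by
  rw [LinearMap.add_apply, LinearMap.add_apply, add_sub_add_comm]
  exact Submodule.add_mem _ (h x) (h' x)

theorem sub {f g f' g' : X →ₗ[A] Y} (h : CongrMod I f g) (h' : CongrMod I f' g') :
    CongrMod I (f - f') (g - g') := fun x ↦ by
  rw [LinearMap.sub_apply, LinearMap.sub_apply, sub_sub_sub_comm]
  exact Submodule.sub_mem _ (h x) (h' x)

theorem comp_right {W : Type*} [AddCommGroup W] [Module A W] {f g : X →ₗ[A] Y}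
    (h : CongrMod I f g) (k : W →ₗ[A] X) : CongrMod I (f ∘ₗ k) (g ∘ₗ k) := fun x ↦ h (k x)

theorem comp_left [Algebra R A] [IsScalarTower R A Y] [IsScalarTower R A Z] {f g : X →ₗ[A] Y}
    (h : CongrMod I f g) (k : Y →ₗ[A] Z) : CongrMod I (k ∘ₗ f) (k ∘ₗ g) := fun x ↦ by
  rw [LinearMap.comp_apply, LinearMap.comp_apply, ← map_sub]
  exact LinearMap.map_mem_smul_top k (h x)

end LinearMap.CongrMod

end Congruence

/-! ### Endomorphisms of a finite module modulo a maximal ideal -/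

section Endomorphisms

variable {R : Type*} [CommRing R] {A : Type*} [Ring A] [Algebra R A]
variable {N : Type*} [AddCommGroup N] [Module R N] [Module A N] [IsScalarTower R A N]

/-- An endomorphism that is the identity modulo a proper ideal `I` becomes invertible after
inverting an element outside `I`. -/
theorem LinearMap.CongrMod.exists_comp_eq_smul_id [Module.Finite R N] {I : Ideal R} (hI : I ≠ ⊤)
    {φ : N →ₗ[A] N} (h : CongrMod I φ LinearMap.id) :
    ∃ (K : N →ₗ[A] N) (s : R), s ∉ I ∧ ∀ x, φ (K x) = s • x := by
  let g : Module.End A N := φ - LinearMap.id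
  let ι : Module.End A N →ₐ[R] Module.End R N :=
    { toFun := fun f ↦ f.restrictScalars R
      map_one' := rfl
      map_mul' := fun _ _ ↦ rfl
      map_zero' := rfl
      map_add' := fun _ _ ↦ rfl
      commutes' := fun _ ↦ rfl }
  have hι : Function.Injective ι := LinearMap.restrictScalars_injective R
  have hrange : LinearMap.range (ι g) ≤ I • ⊤ := by
    rintro _ ⟨x, rfl⟩
    exact h x
  obtain ⟨p, hp, -, hcoeff, hzero⟩ :=
    LinearMap.exists_monic_and_natDegree_eq_and_coeff_mem_pow_and_aeval_eq_zero R (ι g) I hrange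
  have hzero' : Polynomial.aeval g p = 0 := by
    apply hι
    rw [← Polynomial.aeval_algHom_apply, hzero, map_zero]
  obtain ⟨q, hq⟩ := Polynomial.X_sub_C_dvd_sub_C_eval (a := (-1 : R)) (p := p)
  -- Evaluating `p - p(-1) = (X + 1) q` at `g = φ - 1` gives `φ ∘ q(g) = -p(-1)`. The lower
  -- coefficients of `p` lie in `I`, so `p(-1)` is `±1` modulo `I`. As a polynomial in `g`, the map
  -- `q(g)` is `A`-linear.
  refine ⟨-(Polynomial.aeval g q), p.eval (-1), fun hs ↦ ?_, fun x ↦ ?_⟩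
  · rw [Polynomial.eval_eq_sum_range, Finset.sum_range_succ, hp.coeff_natDegree, one_mul] at hs
    have hlow : ∑ k ∈ Finset.range p.natDegree, p.coeff k * (-1) ^ k ∈ I := by
      refine Ideal.sum_mem _ fun k hk ↦ Ideal.mul_mem_right _ _ ?_
      have hk' := Finset.mem_range.mp hk
      exact Ideal.pow_le_self (Nat.sub_ne_zero_of_lt hk') (hcoeff k)
    have hone := (Ideal.add_mem_iff_right _ hlow).mp hs
    exact hI (Ideal.eq_top_of_isUnit_mem _ hone ((isUnit_one.neg).pow _))
  · have h1 := congrArg (Polynomial.aeval g) hq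
    rw [map_sub, hzero', map_mul, map_sub, Polynomial.aeval_X, Polynomial.aeval_C,
      Polynomial.aeval_C] at h1
    have h2 := LinearMap.congr_fun h1 x
    simp only [g, LinearMap.sub_apply, Module.End.mul_apply, map_neg, map_one, LinearMap.zero_apply,
      LinearMap.id_apply, Module.algebraMap_end_apply, LinearMap.neg_apply, Module.End.one_apply]
      at h2 ⊢
    rw [sub_neg_eq_add, sub_add_cancel] at h2
    rw [← h2]
    simp

instance isArtinian_quotient_smul_top [Module.Finite R N] (m : Ideal R) [m.IsMaximal] :
    IsArtinian R (N ⧸ m • (⊤ : Submodule R N)) := by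
  let := Ideal.Quotient.field m
  have : IsArtinian (R ⧸ m) (N ⧸ m • (⊤ : Submodule R N)) := by
    have : Module.Finite (R ⧸ m) (N ⧸ m • (⊤ : Submodule R N)) :=
      Module.Finite.of_restrictScalars_finite R _ _
    infer_instance
  exact isArtinian_of_surjective_algebraMap (R := R ⧸ m) Ideal.Quotient.mk_surjective

theorem isArtinian_end {Q : Type*} [AddCommGroup Q] [Module R Q] [Module.Finite R Q]
    [IsArtinian R Q] : IsArtinian R (Module.End R Q) := by
  obtain ⟨n, s, hs⟩ := Module.Finite.exists_fin (R := R) (M := Q)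
  let ev : Module.End R Q →ₗ[R] (Fin n → Q) := LinearMap.pi fun i ↦ LinearMap.applyₗ (s i)
  refine isArtinian_of_injective ev fun f g hfg ↦ LinearMap.ext_on_range hs fun i ↦ ?_
  exact congrFun hfg i

/-- Stable range one is applied to the image of `End_A(N)` in `End_R(N/mN)`, not to all
endomorphisms of `N/mN`: the image is Artinian, being a submodule of an Artinian `R`-module, and its
elements lift to `N`. -/
theorem LinearMap.CongrMod.exists_leftInverse_add_comp [Module.Finite R N] (m : Ideal R)
    [m.IsMaximal] {a y b : N →ₗ[A] N} (h : CongrMod m (a ∘ₗ y + b) LinearMap.id) :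
    ∃ z u : N →ₗ[A] N, CongrMod m (u ∘ₗ (a + b ∘ₗ z)) LinearMap.id := by
  let U : Submodule R N := m • ⊤
  have hU (f : N →ₗ[A] N) : U ≤ U.comap (f.restrictScalars R) :=
    fun x hx ↦ LinearMap.map_mem_smul_top f hx
  let ρ : Module.End A N →ₐ[R] Module.End R (N ⧸ U) :=
    { toFun := fun f ↦ U.mapQ U (f.restrictScalars R) (hU f)
      map_one' := by ext; rfl
      map_mul' := fun _ _ ↦ by ext; rfl
      map_zero' := by ext; rfl
      map_add' := fun _ _ ↦ by ext; rfl
      commutes' := fun _ ↦ by ext; rfl }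
  have hρ {f g : Module.End A N} (hfg : ρ f = ρ g) : CongrMod m f g := fun x ↦
    (Submodule.Quotient.eq U).mp (LinearMap.congr_fun hfg (Submodule.Quotient.mk x))
  have hρ' {f g : Module.End A N} (hfg : CongrMod m f g) : ρ f = ρ g := by
    ext x
    exact (Submodule.Quotient.eq U).mpr (hfg x)
  have : IsArtinian R (Module.End R (N ⧸ U)) := isArtinian_end
  have : IsArtinianRing ρ.range :=
    isArtinian_of_tower R (inferInstanceAs (IsArtinian R ρ.range.toSubmodule))
  obtain ⟨⟨_, ⟨z, rfl⟩⟩, hz⟩ := HasStableRangeOne.of_isArtinianRing ρ.range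
    ⟨ρ a, a, rfl⟩ ⟨ρ y, y, rfl⟩ ⟨ρ b, b, rfl⟩ (Subtype.ext (by
      have := hρ' (f := a * y + b) (g := 1) h
      rwa [map_add, map_mul, map_one] at this))
  obtain ⟨⟨_, ⟨u, rfl⟩⟩, hu⟩ := hz.exists_left_inv
  refine ⟨z, u, hρ (f := u * (a + b * z)) (g := 1) ?_⟩
  rw [map_mul, map_add, map_mul, map_one]
  exact congrArg Subtype.val hu

end Endomorphisms

/-- The identification of `N ^ j × N ^ k` with `N ^ (j + k)`. -/
def Fin.appendLinearEquiv (A N : Type*) [Semiring A] [AddCommMonoid N] [Module A N] (j k : ℕ) :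
    ((Fin j → N) × (Fin k → N)) ≃ₗ[A] (Fin (j + k) → N) :=
  (LinearEquiv.sumArrowLequivProdArrow (Fin j) (Fin k) A N).symm ≪≫ₗ
    LinearEquiv.funCongrLeft A N finSumFinEquiv.symm

/-! ### Deficiency of a map and its behaviour under shears -/

section Deficiency

variable {R : Type*} [CommRing R] {A : Type*} [Ring A]
variable {M : Type*} [AddCommGroup M] [Module A M]
variable (N : Type*) [AddCommGroup N] [Module A N]
variable {V : Type*} [AddCommGroup V] [Module R V] [Module A V]
variable {V' : Type*} [AddCommGroup V'] [Module R V'] [Module A V']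

/-- A linear map `F : M → V` is `j`-deficient modulo `m` if `j` copies of `N` added to its source
make it split surjective modulo `m`. -/
def LinearMap.DeficientAt (m : Ideal R) (F : M →ₗ[A] V) (j : ℕ) : Prop :=
  ∃ (v : (Fin j → N) →ₗ[A] V) (G : V →ₗ[A] M) (y : V →ₗ[A] (Fin j → N)),
    CongrMod m (F ∘ₗ G + v ∘ₗ y) LinearMap.id

namespace LinearMap.DeficientAt

variable {N} {m : Ideal R}

theorem succ {F : M →ₗ[A] V} {j : ℕ} (h : DeficientAt N m F j) :
    DeficientAt N m F (j + 1) := by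
  obtain ⟨v, G, y, h⟩ := h
  let c := Fin.consLinearEquiv A (fun _ : Fin (j + 1) ↦ N)
  refine ⟨v ∘ₗ LinearMap.snd A N _ ∘ₗ c.symm.toLinearMap, G,
    c.toLinearMap ∘ₗ LinearMap.inr A N _ ∘ₗ y, .trans (.of_eq ?_) h⟩
  ext x
  simp [c]

theorem mono {F : M →ₗ[A] V} {j k : ℕ} (hjk : j ≤ k) (h : DeficientAt N m F j) :
    DeficientAt N m F k := by
  induction k, hjk using Nat.le_induction with
  | base => exact h
  | succ k _ ih => exact ih.succ

theorem congr {F F' : M →ₗ[A] V} {j : ℕ} (hF : CongrMod m F' F) (h : DeficientAt N m F j) :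
    DeficientAt N m F' j := by
  obtain ⟨v, G, y, h⟩ := h
  exact ⟨v, G, y, ((hF.comp_right G).add (.refl m _)).trans h⟩

variable [Algebra R A] [IsScalarTower R A V]

/-- Deficiency is an open condition. -/
theorem exists_notMem [Module.Finite R V] (hm : m ≠ ⊤) {F : M →ₗ[A] V} {j : ℕ}
    (h : DeficientAt N m F j) :
    ∃ s ∉ m, ∀ n : Ideal R, n.IsMaximal → s ∉ n → DeficientAt N n F j := by
  obtain ⟨v, G, y, h⟩ := h
  obtain ⟨K, s, hs, hK⟩ := h.exists_comp_eq_smul_id hm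
  refine ⟨s, hs, fun n hn hsn ↦ ?_⟩
  obtain ⟨t, ht⟩ := hn.exists_inv hsn
  obtain ⟨r, hr, htr⟩ := ht
  -- Here `t` inverts `s` modulo `n`, so the same data, rescaled, serve at `n`.
  refine ⟨v, G ∘ₗ (t • K), y ∘ₗ (t • K), fun x ↦ ?_⟩
  have h1 : F (G ((t • K) x)) + v (y ((t • K) x)) = (t * s) • x := by
    rw [mul_smul, ← hK x]
    exact LinearMap.map_smul_of_tower (F ∘ₗ G + v ∘ₗ y) t (K x)
  simp only [LinearMap.add_apply, LinearMap.comp_apply, LinearMap.id_apply]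
  rw [h1]
  have h2 : (t * s) • x - x = (-r) • x := by
    rw [eq_sub_of_add_eq htr, sub_smul, one_smul, neg_smul]; abel
  rw [h2]
  exact Submodule.smul_mem_smul (n.neg_mem hr) trivial

theorem exists_comp_eq_smul [Module.Finite R V] (hm : m ≠ ⊤) {F : M →ₗ[A] V}
    (h : DeficientAt N m F 0) : ∃ (G : V →ₗ[A] M) (s : R), s ∉ m ∧ ∀ x, F (G x) = s • x := by
  obtain ⟨v, G, y, h⟩ := h
  obtain ⟨K, s, hs, hK⟩ := h.exists_comp_eq_smul_id hm
  refine ⟨G ∘ₗ K, s, hs, fun x ↦ ?_⟩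
  have hy : v (y (K x)) = 0 := by rw [Subsingleton.elim (y (K x)) 0, map_zero]
  have := hK x
  rwa [LinearMap.add_apply, LinearMap.comp_apply, LinearMap.comp_apply, hy, add_zero] at this

theorem of_comp_eq_smul [m.IsMaximal] [Module R M] [IsScalarTower R A M] {F : M →ₗ[A] V}
    {G : V →ₗ[A] M} {s : R} (hs : s ∉ m) (h : ∀ x, F (G x) = s • x) :
    DeficientAt N m F 0 := by
  obtain ⟨t, r, hr, htr⟩ := Ideal.IsMaximal.exists_inv ‹m.IsMaximal› hs
  refine ⟨0, t • G, 0, fun x ↦ ?_⟩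
  have h2 : F (t • G x) - x = (-r) • x := by
    rw [LinearMap.map_smul_of_tower, h, smul_smul, eq_sub_of_add_eq htr, sub_smul, one_smul,
      neg_smul]
    abel
  simp only [LinearMap.add_apply, LinearMap.comp_apply, LinearMap.id_apply, LinearMap.smul_apply,
    LinearMap.zero_apply, add_zero]
  rw [h2]
  exact Submodule.smul_mem_smul (m.neg_mem hr) trivial

variable [IsScalarTower R A V']

theorem comp {F : M →ₗ[A] V} {j : ℕ} (h : DeficientAt N m F j) {T : V →ₗ[A] V'}
    {σ : V' →ₗ[A] V} (hT : T ∘ₗ σ = LinearMap.id) : DeficientAt N m (T ∘ₗ F) j := by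
  obtain ⟨v, G, y, h⟩ := h
  refine ⟨T ∘ₗ v, G ∘ₗ σ, y ∘ₗ σ, .trans (.of_eq ?_)
    (((h.comp_right σ).comp_left T).trans (.of_eq hT))⟩
  ext x
  simp

theorem prod [Module R N] [IsScalarTower R A N] {F : M →ₗ[A] V} {j k : ℕ}
    (h : DeficientAt N m F j) (F' : M →ₗ[A] (Fin k → N)) :
    DeficientAt N m (F.prod F') (j + k) := by
  obtain ⟨v, G, y, h⟩ := h
  let c := Fin.appendLinearEquiv A N j k
  -- The `k` new source copies map identically onto the new coordinates; subtracting `F' ∘ G`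
  -- corrects what `F'` contributes there.
  refine ⟨v.prodMap LinearMap.id ∘ₗ c.symm.toLinearMap, G ∘ₗ LinearMap.fst A _ _,
    c.toLinearMap ∘ₗ (y ∘ₗ LinearMap.fst A _ _).prod
      (LinearMap.snd A _ _ - F' ∘ₗ G ∘ₗ LinearMap.fst A _ _), ?_⟩
  refine .trans (.trans (.of_eq ?_) (((h.comp_right (LinearMap.fst A V (Fin k → N))).comp_left
    (LinearMap.inl A V (Fin k → N))).add (.refl m
      (LinearMap.inr A V (Fin k → N) ∘ₗ LinearMap.snd A V (Fin k → N))))) (.of_eq ?_)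
  · refine LinearMap.ext fun x ↦ Prod.ext ?_ ?_ <;> simp
  · refine LinearMap.ext fun x ↦ Prod.ext ?_ ?_ <;> simp

/-- The shear of `N × V` along a map `a : N → V`, followed by the projection to `V`, lowers a
positive deficiency for a suitable `a`. -/
theorem exists_coprod_comp [Module R N] [IsScalarTower R A N] [Module.Finite R N]
    [m.IsMaximal] {F : M →ₗ[A] N × V} {j : ℕ} (h : DeficientAt N m F (j + 1)) :
    ∃ a : N →ₗ[A] V, DeficientAt N m (a.coprod LinearMap.id ∘ₗ F) j := by
  obtain ⟨v, G, y, h⟩ := h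
  let c := Fin.consLinearEquiv A (fun _ : Fin (j + 1) ↦ N)
  let v₁ : N →ₗ[A] N × V := v ∘ₗ c.toLinearMap ∘ₗ LinearMap.inl A N (Fin j → N)
  let v' : (Fin j → N) →ₗ[A] N × V := v ∘ₗ c.toLinearMap ∘ₗ LinearMap.inr A N (Fin j → N)
  let y₁ : N × V →ₗ[A] N := LinearMap.fst A N (Fin j → N) ∘ₗ c.symm.toLinearMap ∘ₗ y
  let y' : N × V →ₗ[A] (Fin j → N) := LinearMap.snd A N (Fin j → N) ∘ₗ c.symm.toLinearMap ∘ₗ y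
  let Φ : N × V →ₗ[A] N × V := F ∘ₗ G + v' ∘ₗ y'
  have hv (x : N × V) : v (y x) = v₁ (y₁ x) + v' (y' x) := by
    simp only [v₁, v', y₁, y', LinearMap.comp_apply, LinearEquiv.coe_coe]
    rw [← map_add, ← map_add]
    simp
  have hΦ : CongrMod m (v₁ ∘ₗ y₁ + Φ) LinearMap.id := by
    refine .trans (.of_eq (LinearMap.ext fun x ↦ ?_)) h
    simp only [Φ, LinearMap.add_apply, LinearMap.comp_apply, hv]
    abel
  let p₁ := LinearMap.fst A N V
  let p₂ := LinearMap.snd A N V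
  let i₁ := LinearMap.inl A N V
  let i₂ := LinearMap.inr A N V
  -- The relation `v₁ y₁ + Φ ≡ 1` on `N × V` is compressed to the corner `N`, where stable range one
  -- applies.
  obtain ⟨z, u, hu⟩ := CongrMod.exists_leftInverse_add_comp m (a := p₁ ∘ₗ v₁) (y := y₁ ∘ₗ i₁)
    (b := p₁ ∘ₗ Φ ∘ₗ i₁) (((hΦ.comp_right i₁).comp_left p₁).trans
      (.of_eq (LinearMap.ext fun x ↦ by simp [p₁, i₁])))
  let w : N →ₗ[A] N × V := v₁ + Φ ∘ₗ i₁ ∘ₗ z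
  -- Since `u p₁ w ≡ 1`, the image of `w` is modulo `m` a complement of `V`, and `T` is the
  -- projection to `V` along it. From `T w ≡ 0`, `T v₁` agrees with `-T Φ i₁ z`, which makes the
  -- copy of `N` mapped by `v₁` superfluous.
  let a : N →ₗ[A] V := -(p₂ ∘ₗ w ∘ₗ u)
  let T : N × V →ₗ[A] V := a.coprod LinearMap.id
  have hT (x : N × V) : T x = p₂ x - p₂ (w (u (p₁ x))) := by
    simp only [T, a, p₁, p₂, LinearMap.coprod_apply, LinearMap.neg_apply, LinearMap.comp_apply,
      LinearMap.id_apply, LinearMap.fst_apply, LinearMap.snd_apply]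
    abel
  have hTw : CongrMod m (T ∘ₗ w) 0 := by
    refine .trans (.trans (.of_eq (LinearMap.ext fun x ↦ ?_))
      ((CongrMod.refl m (p₂ ∘ₗ w)).sub (hu.comp_left (p₂ ∘ₗ w)))) (.of_eq (by ext x; simp))
    simp only [hT, LinearMap.comp_apply, LinearMap.sub_apply]
    rfl
  -- Chosen so that `T Φ κ = T (v₁ y₁ + Φ) i₂ - T w y₁ i₂`, which is congruent to `T i₂ = 1`.
  let κ : V →ₗ[A] N × V := i₂ - i₁ ∘ₗ z ∘ₗ y₁ ∘ₗ i₂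
  refine ⟨a, T ∘ₗ v', G ∘ₗ κ, y' ∘ₗ κ, ?_⟩
  refine .trans (.trans (.of_eq (LinearMap.ext fun x ↦ ?_))
    (((hΦ.comp_right i₂).comp_left T).sub (hTw.comp_right (y₁ ∘ₗ i₂)))) (.of_eq ?_)
  · have h1 : F (G (κ x)) + v' (y' (κ x)) = Φ (i₂ x) - Φ (i₁ (z (y₁ (i₂ x)))) := by
      rw [← map_sub]; rfl
    change T (F (G (κ x))) + T (v' (y' (κ x))) =
      T (v₁ (y₁ (i₂ x)) + Φ (i₂ x)) - T (v₁ (y₁ (i₂ x)) + Φ (i₁ (z (y₁ (i₂ x)))))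
    rw [← map_add, h1, ← map_sub T, add_sub_add_left_eq_sub]
  · ext x
    simp [T, i₂]

end LinearMap.DeficientAt

end Deficiency

/-! ### Finitely many test points in a Noetherian space -/

open TopologicalSpace in
/-- In a Noetherian space of finite dimension, let `Q` be a decreasing sequence of open sets such
that `Q (dim X)` meets every irreducible closed `X`.  Then `Q (dim X + 1)` meets every irreducible
closed `X` for which `Q (dim X)` does not meet `X` in a certain finite set. -/
theorem TopologicalSpace.NoetherianSpace.exists_finite_inter_nonempty {α : Type*}
    [TopologicalSpace α] [NoetherianSpace α] (d : ℕ)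
    (hd : ∀ X : IrreducibleCloseds α, Order.height X ≤ d) (Q : ℕ → Set α)
    (hQo : ∀ e, IsOpen (Q e)) (hQa : Antitone Q)
    (hQ : ∀ X : IrreducibleCloseds α, ((X : Set α) ∩ Q (Order.height X).toNat).Nonempty) :
    ∃ Z : Set α, Z.Finite ∧ ∀ X : IrreducibleCloseds α,
      ((X : Set α) ∩ Q ((Order.height X).toNat + 1)).Nonempty ∨
      ((X : Set α) ∩ Q (Order.height X).toNat ∩ Z).Nonempty := by
  choose C hCf hCc hCi hCu using fun e : ℕ ↦
    NoetherianSpace.exists_finite_set_isClosed_irreducible (hQo (e + 1)).isClosed_compl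
  choose pt hpt using hQ
  have hlt (X : IrreducibleCloseds α) : Order.height X < ⊤ :=
    (hd X).trans_lt (ENat.natCast_lt_top d)
  -- One point for each irreducible closed set in the chosen finite decompositions of the
  -- complements of `Q (e + 1)`, `e ≤ d`.
  refine ⟨pt '' ((fun X : IrreducibleCloseds α ↦ (X : Set α)) ⁻¹'
    ⋃ e ∈ Finset.range (d + 1), C e), ?_, fun X ↦ ?_⟩
  · refine ((Finset.finite_toSet _).biUnion fun e _ ↦ hCf e).preimage ?_ |>.image _
    exact SetLike.coe_injective.injOn
  by_cases hX : ((X : Set α) ∩ Q ((Order.height X).toNat + 1)).Nonempty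
  · exact Or.inl hX
  right
  set e := (Order.height X).toNat with he
  have heX : (e : ℕ∞) = Order.height X := ENat.natCast_toNat (hlt X).ne
  have hed : e ≤ d := by
    have := hd X
    rw [← heX] at this
    exact_mod_cast this
  have hsub : (X : Set α) ⊆ ⋃₀ ((hCf e).toFinset : Set (Set α)) := by
    rw [Set.Finite.coe_toFinset, ← hCu e]
    exact fun x hx hxQ ↦ hX ⟨x, hx, hxQ⟩
  obtain ⟨T, hT, hXT⟩ := isIrreducible_iff_sUnion_isClosed.mp X.isIrreducible (hCf e).toFinset
    (fun T hT ↦ hCc e T ((hCf e).mem_toFinset.mp hT)) hsub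
  have hT := (hCf e).mem_toFinset.mp hT
  let X' : IrreducibleCloseds α := ⟨T, hCi e T hT, hCc e T hT⟩
  have hXX' : X ≤ X' := hXT
  rcases hXX'.eq_or_lt with h | h
  · refine ⟨pt X, hpt X, X, ?_, rfl⟩
    rw [Set.mem_preimage, Set.mem_iUnion₂]
    refine ⟨e, Finset.mem_range.mpr (Nat.lt_succ_of_le hed), ?_⟩
    rw [h]
    exact hT
  -- A strictly larger `X'` has dimension at least `e + 1`, so its chosen point lies in `Q (e + 1)`,
  -- although `X'` lies in the complement.
  · have h1 := Order.height_add_one_le h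
    rw [← heX, ← ENat.natCast_toNat (hlt X').ne] at h1
    have h2 : e + 1 ≤ (Order.height X').toNat := by exact_mod_cast h1
    have h3 : pt X' ∈ (Q (e + 1))ᶜ := by
      rw [hCu e]
      exact ⟨T, hT, (hpt X').1⟩
    exact (h3 (hQa h2 (hpt X').2)).elim

/-! ### From deficiency bounds to a global splitting -/

section GlobalSplitting

variable {R : Type*} [CommRing R] {A : Type*} [Ring A] [Algebra R A]
variable {M : Type*} [AddCommGroup M] [Module A M]
variable {N : Type*} [AddCommGroup N] [Module A N]
variable {V : Type*} [AddCommGroup V] [Module R V] [Module A V] [IsScalarTower R A V]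

open LinearMap in
theorem isOpen_setOf_deficientAt [Module.Finite R V] (Y : Set (PrimeSpectrum R))
    (hY : ∀ m ∈ Y, m.asIdeal.IsMaximal) (F : M →ₗ[A] V) (j : ℕ) :
    IsOpen {m : Y | DeficientAt N m.1.asIdeal F j} := by
  refine isOpen_iff_forall_mem_open.mpr fun m hm ↦ ?_
  obtain ⟨s, hs, hsn⟩ := DeficientAt.exists_notMem (hY _ m.2).ne_top hm
  exact ⟨Subtype.val ⁻¹' (PrimeSpectrum.basicOpen s : Set (PrimeSpectrum R)),
    fun n hn ↦ hsn _ (hY _ n.2) hn,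
    (PrimeSpectrum.basicOpen s).isOpen.preimage continuous_subtype_val, hs⟩

/-- The Chinese remainder theorem for linear maps. -/
theorem LinearMap.exists_forall_congrMod {κ : Type*} [Finite κ] {I : κ → Ideal R}
    (hI : Pairwise (Function.onFun IsCoprime I)) (a : κ → N →ₗ[A] V) :
    ∃ b : N →ₗ[A] V, ∀ k, CongrMod (I k) b (a k) := by
  classical
  cases nonempty_fintype κ
  choose r hr using fun k ↦ Ideal.exists_forall_sub_mem_ideal hI (Pi.single k (1 : R))
  refine ⟨∑ k, r k • a k, fun l x ↦ ?_⟩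
  have h1 : (∑ k, r k • a k) x - a l x = ∑ k, (r k - (Pi.single k (1 : R) : κ → R) l) • a k x := by
    simp only [LinearMap.sum_apply, LinearMap.smul_apply, sub_smul, Finset.sum_sub_distrib]
    congr 1
    rw [Finset.sum_eq_single l (fun k _ hk ↦ by rw [Pi.single_eq_of_ne hk.symm, zero_smul])
      (by simp)]
    simp
  rw [h1]
  exact Submodule.sum_mem _ fun k _ ↦ Submodule.smul_mem_smul (hr k l) trivial

variable [Module R N] [IsScalarTower R A N]

namespace LinearMap.DeficientAt

/-- A shear adapted to the least possible `j` works for every `j`. This uniformity matters because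
one test point may serve sets `X` of different dimensions. -/
theorem exists_forall_coprod_comp [Module.Finite R N] (m : Ideal R) [m.IsMaximal]
    (F : M →ₗ[A] N × V) :
    ∃ a : N →ₗ[A] V, ∀ j, DeficientAt N m F (j + 1) →
      DeficientAt N m (a.coprod LinearMap.id ∘ₗ F) j := by
  classical
  by_cases h : ∃ j, DeficientAt N m F (j + 1)
  · obtain ⟨a, ha⟩ := (Nat.find_spec h).exists_coprod_comp
    exact ⟨a, fun j hj ↦ ha.mono (Nat.find_min' h hj)⟩
  · exact ⟨0, fun j hj ↦ (h ⟨j, hj⟩).elim⟩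

end LinearMap.DeficientAt

open TopologicalSpace LinearMap

/-- The number of maps can be lowered as long as it exceeds `t`, keeping the deficiency at a
general point of every irreducible closed set under control. -/
theorem exists_deficientAt_of_succ [Module.Finite R N] (Y : Set (PrimeSpectrum R))
    (hY : ∀ m ∈ Y, m.asIdeal.IsMaximal) [NoetherianSpace Y] (d : ℕ)
    (hd : ∀ X : IrreducibleCloseds Y, Order.height X ≤ d) (t n : ℕ)
    (F : M →ₗ[A] (Fin (n + 1) → N))
    (hF : ∀ X : IrreducibleCloseds Y, ∃ m ∈ X,
      DeficientAt N m.1.asIdeal F (n + 1 - ((Order.height X).toNat + t))) :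
    ∃ F' : M →ₗ[A] (Fin n → N), ∀ X : IrreducibleCloseds Y, ∃ m ∈ X,
      DeficientAt N m.1.asIdeal F' (n - ((Order.height X).toNat + t)) := by
  classical
  let c := Fin.consLinearEquiv A (fun _ : Fin (n + 1) ↦ N)
  let F₀ : M →ₗ[A] N × (Fin n → N) := c.symm.toLinearMap ∘ₗ F
  have hF₀ {m : Ideal R} {j : ℕ} (h : DeficientAt N m F j) : DeficientAt N m F₀ j :=
    h.comp (σ := c.toLinearMap) (by ext x <;> simp)
  obtain ⟨Z, hZ, hZX⟩ := NoetherianSpace.exists_finite_inter_nonempty d hd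
    (fun e ↦ {m : Y | DeficientAt N m.1.asIdeal F (n + 1 - (e + t))})
    (fun e ↦ isOpen_setOf_deficientAt Y hY F _)
    (fun e e' he m hm ↦ DeficientAt.mono (by omega) hm) hF
  have hmax (m : Y) : m.1.asIdeal.IsMaximal := hY _ m.2
  choose a ha using fun m : Y ↦ DeficientAt.exists_forall_coprod_comp m.1.asIdeal F₀
  have := hZ.to_subtype
  obtain ⟨b, hb⟩ := LinearMap.exists_forall_congrMod
    (I := fun m : Z ↦ m.1.1.asIdeal) (fun m m' hmm' ↦
      Ideal.isCoprime_of_isMaximal fun h ↦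
        hmm' (Subtype.ext (Subtype.ext (PrimeSpectrum.ext h)))) (fun m ↦ a m.1)
  have hcomp {m : Ideal R} {j : ℕ} (h : DeficientAt N m F j) :
      DeficientAt N m (b.coprod LinearMap.id ∘ₗ F₀) j :=
    (hF₀ h).comp (σ := LinearMap.inr A N (Fin n → N)) (by ext x; simp)
  refine ⟨b.coprod LinearMap.id ∘ₗ F₀, fun X ↦ ?_⟩
  rcases hZX X with ⟨m, hmX, hm⟩ | ⟨m, ⟨hmX, hm⟩, hmZ⟩
  · refine ⟨m, hmX, ?_⟩
    have := hcomp hm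
    rwa [show n + 1 - ((Order.height X).toNat + 1 + t) = n - ((Order.height X).toNat + t) by
      omega] at this
  · refine ⟨m, hmX, ?_⟩
    -- In this range both truncated differences are 0, so it is enough that shears do not raise the
    -- deficiency.
    by_cases h0 : n + 1 ≤ (Order.height X).toNat + t
    · exact (hcomp hm).mono (by omega)
    · refine DeficientAt.congr ?_ (ha m _ (hF₀ (?_ : DeficientAt N m.1.asIdeal F _)))
      · intro x
        have := hb ⟨m, hmZ⟩ (F₀ x).1
        simpa [LinearMap.coprod_apply] using this
      · rwa [show n - ((Order.height X).toNat + t) + 1 = n + 1 - ((Order.height X).toNat + t) by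
          omega]

theorem exists_deficientAt_zero [Module.Finite R N] (Y : Set (PrimeSpectrum R))
    (hY : ∀ m ∈ Y, m.asIdeal.IsMaximal) [NoetherianSpace Y] (d : ℕ)
    (hd : ∀ X : IrreducibleCloseds Y, Order.height X ≤ d) (t k : ℕ)
    (F : M →ₗ[A] (Fin (t + k) → N))
    (hF : ∀ X : IrreducibleCloseds Y, ∃ m ∈ X,
      DeficientAt N m.1.asIdeal F (t + k - ((Order.height X).toNat + t))) :
    ∃ F' : M →ₗ[A] (Fin t → N), ∀ m ∈ Y, DeficientAt N m.asIdeal F' 0 := by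
  induction k with
  | zero =>
    refine ⟨F, fun m hm ↦ ?_⟩
    -- An open set meeting the closure of a point contains that point.
    obtain ⟨x, hx, hxF⟩ := hF ⟨closure {⟨m, hm⟩}, isIrreducible_singleton.closure,
      isClosed_closure⟩
    have hx0 : DeficientAt N x.1.asIdeal F 0 := hxF.mono (by omega)
    obtain ⟨y, hyF, rfl⟩ := mem_closure_iff.mp hx _
      (isOpen_setOf_deficientAt (N := N) Y hY F 0) hx0
    exact hyF
  | succ k ih =>
    obtain ⟨F', hF'⟩ := exists_deficientAt_of_succ Y hY d hd t (t + k) F hF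
    exact ih F' hF'

/-- Local splittings are glued by juxtaposing the maps. The number of target copies minus the
deficiency bound stays equal to `w`, which is what the later descent needs. -/
theorem exists_forall_deficientAt [Module R M] [IsScalarTower R A M] [Module.Finite R N]
    (Y : Set (PrimeSpectrum R)) (hY : ∀ m ∈ Y, m.asIdeal.IsMaximal) [NoetherianSpace Y] (w : ℕ)
    (hloc : ∀ m ∈ Y, ∃ (f : M →ₗ[A] (Fin w → N)) (g : (Fin w → N) →ₗ[A] M) (s : R),
      s ∉ m.asIdeal ∧ ∀ x, f (g x) = s • x) :
    ∃ (k : ℕ) (F : M →ₗ[A] (Fin (w + k) → N)), ∀ m ∈ Y, DeficientAt N m.asIdeal F k := by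
  suffices h : ∃ (k : ℕ) (F : M →ₗ[A] (Fin (w + k) → N)),
      ∀ m : Y, m ∈ (Set.univ : Set Y) → DeficientAt N m.1.asIdeal F k by
    obtain ⟨k, F, h⟩ := h
    exact ⟨k, F, fun m hm ↦ h ⟨m, hm⟩ trivial⟩
  refine (NoetherianSpace.isCompact (Set.univ : Set Y)).induction_on
    (p := fun U ↦ ∃ (k : ℕ) (F : M →ₗ[A] (Fin (w + k) → N)),
      ∀ m : Y, m ∈ U → DeficientAt N m.1.asIdeal F k) ⟨0, 0, fun _ h ↦ h.elim⟩
    (fun U U' hU ⟨k, F, h⟩ ↦ ⟨k, F, fun m hm ↦ h m (hU hm)⟩) ?_ ?_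
  · rintro U₁ U₂ ⟨k₁, F₁, h₁⟩ ⟨k₂, F₂, h₂⟩
    let c := Fin.appendLinearEquiv A N (w + k₁) (w + k₂) ≪≫ₗ
      LinearEquiv.funCongrLeft A N (finCongr (Nat.add_assoc w k₁ (w + k₂)).symm)
    refine ⟨k₁ + (w + k₂), c.toLinearMap ∘ₗ F₁.prod F₂, fun m hm ↦ ?_⟩
    rcases hm with hm | hm
    · exact ((h₁ m hm).prod F₂).comp (σ := c.symm.toLinearMap)
        (LinearMap.ext fun x ↦ c.apply_symm_apply x)
    · have h := (((h₂ m hm).prod F₁).comp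
        (T := (LinearEquiv.prodComm A (Fin (w + k₂) → N) (Fin (w + k₁) → N)).toLinearMap)
        (σ := (LinearEquiv.prodComm A (Fin (w + k₁) → N) (Fin (w + k₂) → N)).toLinearMap)
        (LinearMap.ext fun x ↦ rfl)).comp (T := c.toLinearMap) (σ := c.symm.toLinearMap)
        (LinearMap.ext fun x ↦ c.apply_symm_apply x)
      exact h.mono (by omega)
  · rintro m -
    have := hY _ m.2
    obtain ⟨f, g, s, hs, hfg⟩ := hloc m.1 m.2
    refine ⟨{n : Y | DeficientAt N n.1.asIdeal f 0}, mem_nhdsWithin_of_mem_nhds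
      ((isOpen_setOf_deficientAt Y hY f 0).mem_nhds (DeficientAt.of_comp_eq_smul hs hfg)),
      0, f, fun n hn ↦ hn⟩

/-- A map is split surjective if it is so at every maximal ideal, up to an element outside the
ideal. -/
theorem exists_comp_eq_id_of_forall_isMaximal [Module R M] [IsScalarTower R A M]
    (F : M →ₗ[A] V)
    (h : ∀ m : Ideal R, m.IsMaximal → ∃ (G : V →ₗ[A] M) (s : R), s ∉ m ∧ ∀ x, F (G x) = s • x) :
    ∃ G : V →ₗ[A] M, F ∘ₗ G = LinearMap.id := by
  let I : Ideal R :=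
    { carrier := {s | ∃ G : V →ₗ[A] M, ∀ x, F (G x) = s • x}
      zero_mem' := ⟨0, fun x ↦ by simp⟩
      add_mem' := fun ⟨G, hG⟩ ⟨G', hG'⟩ ↦ ⟨G + G', fun x ↦ by
        rw [LinearMap.add_apply, map_add, hG, hG', add_smul]⟩
      smul_mem' := fun r s ⟨G, hG⟩ ↦ ⟨r • G, fun x ↦ by
        rw [LinearMap.smul_apply, LinearMap.map_smul_of_tower, hG, smul_eq_mul, mul_smul]⟩ }
  have hI : I = ⊤ := by
    by_contra hne
    obtain ⟨m, hm, hIm⟩ := Ideal.exists_le_maximal I hne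
    obtain ⟨G, s, hs, hG⟩ := h m hm
    exact hs (hIm ⟨G, hG⟩)
  obtain ⟨G, hG⟩ := (Ideal.eq_top_iff_one I).mp hI
  exact ⟨G, LinearMap.ext fun x ↦ by simpa using hG x⟩

theorem exists_comp_eq_id_of_forall_maxSupport [Module R M] [IsScalarTower R A M]
    [Module.Finite R N] [NoetherianSpace (RightModule.maxSupport R N)] (d : ℕ)
    (hd : ∀ X : IrreducibleCloseds (RightModule.maxSupport R N), Order.height X ≤ d) (t : ℕ)
    (hloc : ∀ m ∈ RightModule.maxSupport R N,
      ∃ (f : M →ₗ[A] (Fin (t + d) → N)) (g : (Fin (t + d) → N) →ₗ[A] M) (s : R),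
        s ∉ m.asIdeal ∧ ∀ x, f (g x) = s • x) :
    ∃ (F : M →ₗ[A] (Fin t → N)) (G : (Fin t → N) →ₗ[A] M), F ∘ₗ G = LinearMap.id := by
  have hY : ∀ m ∈ RightModule.maxSupport R N, m.asIdeal.IsMaximal := fun m hm ↦ hm.1
  obtain ⟨k, F₀, hF₀⟩ := exists_forall_deficientAt _ hY (t + d) hloc
  let c := LinearEquiv.funCongrLeft A N (finCongr (Nat.add_assoc t d k).symm)
  obtain ⟨F, hF⟩ := exists_deficientAt_zero _ hY d hd t (d + k) (c.toLinearMap ∘ₗ F₀) (fun X ↦ by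
    obtain ⟨m, hm⟩ := X.isIrreducible.nonempty
    refine ⟨m, hm, DeficientAt.mono ?_ ((hF₀ m.1 m.2).comp (T := c.toLinearMap)
      (σ := c.symm.toLinearMap) (LinearMap.ext fun x ↦ c.apply_symm_apply x))⟩
    -- Initially the allowed deficiency is `d + k - dim X`, which is at least `k` because `dim X ≤
    -- d`.
    have := ENat.toNat_le_of_le_natCast (hd X)
    omega)
  refine ⟨F, exists_comp_eq_id_of_forall_isMaximal (R := R) F fun m hm ↦ ?_⟩
  by_cases hmY : (⟨m, hm.isPrime⟩ : PrimeSpectrum R) ∈ RightModule.maxSupport R N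
  · exact (hF _ hmY).exists_comp_eq_smul hm.ne_top
  -- Away from the support a scalar outside `m` kills `N`, so the zero map is a splitting up to that
  -- scalar.
  · have : ¬ Module.annihilator R N ≤ m := fun h ↦
      hmY ⟨hm, (Module.mem_support_iff_of_finite (p := ⟨m, hm.isPrime⟩)).mpr h⟩
    obtain ⟨s, hs, hsm⟩ := Set.not_subset.mp this
    refine ⟨0, s, hsm, fun x ↦ funext fun i ↦ ?_⟩
    simp [Module.mem_annihilator.mp hs (x i)]

end GlobalSplitting

/-! ### Lifting maps from localizations -/

section Lifting

variable {R : Type*} [CommRing R] (W : Submonoid R) {A : Type*} [Ring A] [Algebra R A]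
  [Module.Finite R A]
variable {L L' : Type*} [AddCommGroup L] [AddCommGroup L'] [Module R L] [Module R L']
  [Module A L] [Module A L'] [IsScalarTower R A L] [IsScalarTower R A L']

/-- A linear map from a finitely presented module to a localization lifts, up to a denominator. The
ring `A` need not be commutative; the localization is over a central subring. -/
theorem Module.FinitePresentation.exists_lift_of_isLocalizedModule_restrictScalars
    {P : Type*} [AddCommGroup P] [Module A P] (hP : Module.FinitePresentation A P)
    (ℓ : L →ₗ[A] L') [IsLocalizedModule W (ℓ.restrictScalars R)] (φ : P →ₗ[A] L') :
    ∃ (h : P →ₗ[A] L) (s : R), s ∈ W ∧ ∀ x, ℓ (h x) = s • φ x := by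
  obtain ⟨n, k, π, κ, hπ, hκ⟩ := Module.FinitePresentation.exists_fin' A P
  obtain ⟨b, hb⟩ := IsLocalizedModule.exist_integer_multiples W (ℓ.restrictScalars R)
    (Finset.univ : Finset (Fin n)) (fun i ↦ φ (π (Pi.single i 1)))
  choose l hl using fun i ↦ hb i (Finset.mem_univ i)
  let h₀ : (Fin n → A) →ₗ[A] L := Fintype.linearCombination A l
  have hh₀ : ℓ ∘ₗ h₀ = (b : R) • (φ ∘ₗ π) := by
    refine LinearMap.pi_ext' fun i ↦ LinearMap.ext_ring ?_
    have := hl i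
    simp only [LinearMap.restrictScalars_apply] at this
    simp [h₀, this]
  -- The relations module `A^k` is finite over `R`, so one further denominator makes `h₀` kill all
  -- relations.
  obtain ⟨c, hc⟩ := Module.Finite.exists_smul_of_comp_eq_of_isLocalizedModule W
    (ℓ.restrictScalars R) ((h₀ ∘ₗ κ).restrictScalars R) 0 (by
      refine LinearMap.ext fun x ↦ ?_
      have h1 := LinearMap.congr_fun hh₀ (κ x)
      have h2 : π (κ x) = 0 := (hκ _).mpr ⟨x, rfl⟩
      simpa [h2] using h1)
  have hker : LinearMap.ker π ≤ LinearMap.ker ((c : R) • h₀) := by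
    intro x hx
    obtain ⟨y, rfl⟩ := (hκ x).mp hx
    have := LinearMap.congr_fun hc y
    simpa [Submonoid.smul_def] using this
  refine ⟨(LinearMap.ker π).liftQ _ hker ∘ₗ (π.quotKerEquivOfSurjective hπ).symm.toLinearMap,
    c * b, (c * b).2, fun x ↦ ?_⟩
  obtain ⟨y, rfl⟩ := hπ x
  have h1 : (π.quotKerEquivOfSurjective hπ).symm (π y) = Submodule.Quotient.mk y := by
    rw [LinearEquiv.symm_apply_eq]; rfl
  have h2 := LinearMap.congr_fun hh₀ y
  simp only [LinearMap.comp_apply, LinearMap.smul_apply] at h2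
  rw [LinearMap.comp_apply, LinearEquiv.coe_coe, h1, Submodule.liftQ_apply, LinearMap.smul_apply,
    LinearMap.map_smul_of_tower, h2, mul_smul]

/-- If `M` is a direct summand of a direct sum of finitely presented modules, then a splitting of
a localization of `M` onto a localization of `V` is defined globally, up to a denominator. -/
theorem exists_comp_eq_smul_of_localized
    {M M' : Type*} [AddCommGroup M] [AddCommGroup M'] [Module R M] [Module R M']
    [Module A M] [Module A M'] [IsScalarTower R A M] [IsScalarTower R A M']
    {ι : Type*} (P : ι → Type*) [∀ i, AddCommGroup (P i)] [∀ i, Module A (P i)]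
    (hP : ∀ i, Module.FinitePresentation A (P i))
    {Q : Type*} [AddCommGroup Q] [Module A Q] (e : (M × Q) ≃ₗ[A] DirectSum ι P)
    (hL : Module.FinitePresentation A L)
    (ℓM : M →ₗ[A] M') [IsLocalizedModule W (ℓM.restrictScalars R)]
    (ℓ : L →ₗ[A] L') [IsLocalizedModule W (ℓ.restrictScalars R)]
    (φ : M' →ₗ[A] L') (γ : L' →ₗ[A] M') (hφγ : ∀ x, φ (γ x) = x) :
    ∃ (f : M →ₗ[A] L) (g : L →ₗ[A] M) (s : R), s ∈ W ∧ ∀ x, f (g x) = s • x := by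
  classical
  obtain ⟨g, s₁, hs₁, hg⟩ :=
    hL.exists_lift_of_isLocalizedModule_restrictScalars W ℓM (γ ∘ₗ ℓ)
  let π : DirectSum ι P →ₗ[A] M := LinearMap.fst A M Q ∘ₗ e.symm.toLinearMap
  let i : M →ₗ[A] DirectSum ι P := e.toLinearMap ∘ₗ LinearMap.inl A M Q
  have hπi (x : M) : π (i x) = x := by simp [π, i]
  choose h s hs hh using fun k ↦ (hP k).exists_lift_of_isLocalizedModule_restrictScalars W ℓ
    (φ ∘ₗ ℓM ∘ₗ π ∘ₗ DirectSum.lof A ι P k)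
  obtain ⟨n, v, hv⟩ := Module.Finite.exists_fin (R := A) (M := L)
  -- `M` need not be finitely presented, so `φ` itself may not lift. But `L` is finitely generated,
  -- so `i ∘ g` meets only finitely many summands, and lifting `φ` on those is enough.
  let I₀ : Finset ι := Finset.univ.biUnion fun j ↦ DFinsupp.support (i (g (v j)))
  have hI₀ (x : L) (k : ι) (hk : k ∉ I₀) : i (g x) k = 0 := by
    have : DirectSum.component A ι P k ∘ₗ i ∘ₗ g = 0 := by
      refine LinearMap.ext_on_range hv fun j ↦ ?_
      by_contra hne
      exact hk (Finset.mem_biUnion.mpr ⟨j, Finset.mem_univ j, DFinsupp.mem_support_iff.mpr hne⟩)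
    exact LinearMap.congr_fun this x
  have hsum (x : L) : ∑ k ∈ I₀, DirectSum.lof A ι P k (i (g x) k) = i (g x) := by
    refine DFinsupp.ext fun k ↦ ?_
    by_cases hk : k ∈ I₀
    · rw [DFinsupp.finsetSum_apply, Finset.sum_eq_single k]
      · exact DirectSum.of_eq_same k _
      · exact fun l _ hlk ↦ DirectSum.of_eq_of_ne _ _ _ hlk.symm
      · exact fun h ↦ (h hk).elim
    · rw [hI₀ x k hk, DFinsupp.finsetSum_apply]
      exact Finset.sum_eq_zero fun l hl ↦ DirectSum.of_eq_of_ne _ _ _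
        fun h ↦ hk (h ▸ hl)
  let H : DirectSum ι P →ₗ[A] L :=
    ∑ k ∈ I₀, (∏ l ∈ I₀.erase k, s l) • (h k ∘ₗ DirectSum.component A ι P k)
  have hH (x : L) : ℓ (H (i (g x))) = ((∏ l ∈ I₀, s l) * s₁) • ℓ x := by
    have h1 : ℓ (H (i (g x))) = ∑ k ∈ I₀,
        (∏ l ∈ I₀, s l) • φ (ℓM (π (DirectSum.lof A ι P k (i (g x) k)))) := by
      simp only [H, LinearMap.sum_apply, map_sum]
      refine Finset.sum_congr rfl fun k hk ↦ ?_
      rw [LinearMap.smul_apply, LinearMap.map_smul_of_tower, LinearMap.comp_apply, hh,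
        ← mul_smul, Finset.prod_erase_mul _ _ hk]
      rfl
    rw [h1, ← Finset.smul_sum, ← map_sum, ← map_sum, ← map_sum, hsum, hπi, hg,
      LinearMap.map_smul_of_tower, LinearMap.comp_apply, hφγ, mul_smul]
  have : Module.Finite R L := Module.Finite.trans A L
  -- The identity holds only after `ℓ`; as `L` is finite over `R`, a single `u` makes it hold in
  -- `L`.
  obtain ⟨u, hu⟩ := Module.Finite.exists_smul_of_comp_eq_of_isLocalizedModule W
    (ℓ.restrictScalars R) ((H ∘ₗ i ∘ₗ g).restrictScalars R)
    (((∏ l ∈ I₀, s l) * s₁) • LinearMap.id) (by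
      ext x
      have := hH x
      simpa using this)
  refine ⟨(u : R) • (H ∘ₗ i), g, u * ((∏ l ∈ I₀, s l) * s₁),
    W.mul_mem u.2 (W.mul_mem (W.prod_mem fun k _ ↦ hs k) hs₁), fun x ↦ ?_⟩
  have := LinearMap.congr_fun hu x
  simpa [Submonoid.smul_def, mul_smul] using this

end Lifting

/-! ### Localized right modules and bounds on splitting capacities -/

namespace RightModule

section LocalizationMaps

variable {R : Type*} [CommRing R] (W : Submonoid R)
variable (S : Type*) [Ring S] [Algebra R S]

/-- The ring homomorphism `S → W⁻¹S`, between opposite rings. -/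
def localizationRingHom : Sᵐᵒᵖ →+* (LocalizedModule W S)ᵐᵒᵖ :=
  RingHom.op
    { toFun := fun s ↦ LocalizedModule.mk s 1
      map_one' := by rw [OreLocalization.one_def]
      map_mul' := fun s s' ↦ by rw [LocalizedModule.mk_mul_mk, one_mul]
      map_zero' := LocalizedModule.zero_mk 1
      map_add' := fun s s' ↦ by rw [LocalizedModule.mk_add_mk, one_smul, one_smul, one_mul] }

variable (M : Type*) [AddCommGroup M] [Module R M] [Module Sᵐᵒᵖ M] [IsScalarTower R Sᵐᵒᵖ M]

/-- The localization `W⁻¹M` as a right `S`-module. -/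
abbrev localizedBaseModule : Module Sᵐᵒᵖ (LocalizedModule W M) :=
  Module.compHom _ (localizationRingHom W S)

attribute [local instance] localizedBaseModule

variable {S M} in
theorem op_smul_mk (s : S) (x : M) (v : W) :
    op s • LocalizedModule.mk x v = LocalizedModule.mk (op s • x) v := by
  refine (op_mk_smul_mk W s 1 x v).trans ?_
  rw [one_mul]

theorem isScalarTower_localizedModule : IsScalarTower R Sᵐᵒᵖ (LocalizedModule W M) where
  smul_assoc r s y := by
    induction s using MulOpposite.rec' with | _ s => _
    induction y with
    | h x v =>
      rw [← op_smul, op_smul_mk, op_smul_mk, LocalizedModule.smul'_mk, op_smul_smul]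

/-- The localization map `M → W⁻¹M` as a map of right `S`-modules. -/
def localizationMap : M →ₗ[Sᵐᵒᵖ] LocalizedModule W M where
  toFun x := LocalizedModule.mk x 1
  map_add' := (LocalizedModule.mkLinearMap W M).map_add
  map_smul' s x := (op_smul_mk W s.unop x 1).symm

variable {S M} in
/-- The localization of a map of right `S`-modules, as a map of right `W⁻¹S`-modules. -/
noncomputable def mapLocalized {L : Type*} [AddCommGroup L] [Module R L] [Module Sᵐᵒᵖ L]
    [IsScalarTower R Sᵐᵒᵖ L] (f : M →ₗ[Sᵐᵒᵖ] L) :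
    LocalizedModule W M →ₗ[(LocalizedModule W S)ᵐᵒᵖ] LocalizedModule W L where
  toFun := LocalizedModule.map W (f.restrictScalars R)
  map_add' := map_add _
  map_smul' a y := by
    induction a using MulOpposite.rec' with | _ a => _
    induction a with
    | h s u =>
      induction y with
      | h x v =>
        rw [RingHom.id_apply, op_mk_smul_mk, LocalizedModule.map_mk, LocalizedModule.map_mk,
          op_mk_smul_mk, LinearMap.restrictScalars_apply, LinearMap.restrictScalars_apply,
          map_smul]

variable {S M} in
theorem mapLocalized_mk {L : Type*} [AddCommGroup L] [Module R L] [Module Sᵐᵒᵖ L]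
    [IsScalarTower R Sᵐᵒᵖ L] (f : M →ₗ[Sᵐᵒᵖ] L) (x : M) (v : W) :
    mapLocalized W f (LocalizedModule.mk x v) = LocalizedModule.mk (f x) v :=
  LocalizedModule.map_mk W _ x v

variable {S M}

theorem exists_comp_eq_smul_of_isSplitSurjective [Module.Finite R S]
    {N : Type*} [AddCommGroup N] [Module R N] [Module Sᵐᵒᵖ N] [IsScalarTower R Sᵐᵒᵖ N]
    {ι : Type*} (P : ι → Type*) [∀ i, AddCommGroup (P i)] [∀ i, Module Sᵐᵒᵖ (P i)]
    (hP : ∀ i, Module.FinitePresentation Sᵐᵒᵖ (P i))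
    {Q : Type*} [AddCommGroup Q] [Module Sᵐᵒᵖ Q] (e : (M × Q) ≃ₗ[Sᵐᵒᵖ] DirectSum ι P)
    (hN : Module.FinitePresentation Sᵐᵒᵖ N) {w : ℕ}
    (φ : LocalizedModule W M →ₗ[(LocalizedModule W S)ᵐᵒᵖ] (Fin w → LocalizedModule W N))
    (hφ : IsSplitSurjective φ) :
    ∃ (f : M →ₗ[Sᵐᵒᵖ] (Fin w → N)) (g : (Fin w → N) →ₗ[Sᵐᵒᵖ] M) (s : R),
      s ∈ W ∧ ∀ x, f (g x) = s • x := by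
  have := isScalarTower_localizedModule W S M
  have := isScalarTower_localizedModule W S N
  obtain ⟨γ, hγ⟩ := hφ
  have : IsLocalizedModule W ((localizationMap W S M).restrictScalars R) :=
    inferInstanceAs (IsLocalizedModule W (LocalizedModule.mkLinearMap W M))
  let ℓ : (Fin w → N) →ₗ[Sᵐᵒᵖ] (Fin w → LocalizedModule W N) :=
    LinearMap.pi fun i ↦ localizationMap W S N ∘ₗ LinearMap.proj i
  have : IsLocalizedModule W (ℓ.restrictScalars R) :=
    inferInstanceAs (IsLocalizedModule W
      (LinearMap.pi fun i : Fin w ↦ LocalizedModule.mkLinearMap W N ∘ₗ LinearMap.proj i))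
  let φ' : LocalizedModule W M →ₗ[Sᵐᵒᵖ] (Fin w → LocalizedModule W N) :=
    { toFun := φ
      map_add' := φ.map_add
      map_smul' := fun s x ↦ φ.map_smul (localizationRingHom W S s) x }
  let γ' : (Fin w → LocalizedModule W N) →ₗ[Sᵐᵒᵖ] LocalizedModule W M :=
    { toFun := γ
      map_add' := γ.map_add
      map_smul' := fun s x ↦ γ.map_smul (localizationRingHom W S s) x }
  exact exists_comp_eq_smul_of_localized W P hP e inferInstance
    (localizationMap W S M) ℓ φ' γ' fun x ↦ LinearMap.congr_fun hγ x

end LocalizationMaps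

section CapacityBounds

theorem IsSplitSurjective.of_le {A : Type*} [Ring A] {M N : Type*} [AddCommGroup M]
    [AddCommGroup N] [Module A M] [Module A N] {w t : ℕ} (hwt : w ≤ t)
    {f : M →ₗ[A] (Fin t → N)} (hf : IsSplitSurjective f) :
    ∃ f' : M →ₗ[A] (Fin w → N), IsSplitSurjective f' := by
  obtain ⟨k, rfl⟩ := Nat.exists_eq_add_of_le hwt
  obtain ⟨g, hg⟩ := hf
  let c := Fin.appendLinearEquiv A N w k
  refine ⟨LinearMap.fst A _ _ ∘ₗ c.symm.toLinearMap ∘ₗ f,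
    g ∘ₗ c.toLinearMap ∘ₗ LinearMap.inl A _ _, LinearMap.ext fun x ↦ ?_⟩
  have := LinearMap.congr_fun hg (c (x, 0))
  simp only [LinearMap.comp_apply, LinearMap.id_apply] at this
  simp [this]

/-- The admissible `t` are closed downwards, since superfluous copies can be projected away. -/
theorem natCast_le_splittingCapacity_iff {S : Type*} [Ring S] {M N : Type*} [AddCommGroup M]
    [AddCommGroup N] [Module Sᵐᵒᵖ M] [Module Sᵐᵒᵖ N] {w : ℕ} :
    (w : ℕ∞) ≤ splittingCapacity S M N ↔
      ∃ f : M →ₗ[Sᵐᵒᵖ] (Fin w → N), IsSplitSurjective f := by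
  refine ⟨fun h ↦ ?_, fun h ↦ le_iSup₂_of_le w h le_rfl⟩
  cases w with
  | zero => exact ⟨0, 0, LinearMap.ext fun x ↦ Subsingleton.elim _ _⟩
  | succ w =>
    have hlt : (w : ℕ∞) < splittingCapacity S M N :=
      lt_of_lt_of_le (by exact_mod_cast Nat.lt_succ_self w) h
    simp only [splittingCapacity, lt_iSup_iff] at hlt
    obtain ⟨t, ⟨f, hf⟩, hwt⟩ := hlt
    exact hf.of_le (by exact_mod_cast hwt)

variable {R : Type*} [CommRing R] {S : Type*} [Ring S] [Algebra R S]
variable {M : Type*} [AddCommGroup M] [Module R M] [Module Sᵐᵒᵖ M] [IsScalarTower R Sᵐᵒᵖ M]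
variable {N : Type*} [AddCommGroup N] [Module R N] [Module Sᵐᵒᵖ N] [IsScalarTower R Sᵐᵒᵖ N]

theorem splittingCapacity_le_localSplittingCapacity (p : PrimeSpectrum R) :
    splittingCapacity S M N ≤ localSplittingCapacity S M N p := by
  refine ENat.forall_natCast_le_iff_le.mp fun w hw ↦ ?_
  obtain ⟨f, g, hfg⟩ := natCast_le_splittingCapacity_iff.mp hw
  refine natCast_le_splittingCapacity_iff.mpr ?_
  let W := p.asIdeal.primeCompl
  refine ⟨LinearMap.pi fun i ↦ mapLocalized W (LinearMap.proj i ∘ₗ f),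
    ∑ j, mapLocalized W (g ∘ₗ LinearMap.single _ _ j) ∘ₗ LinearMap.proj j, ?_⟩
  refine LinearMap.pi_ext' fun j ↦ LinearMap.ext fun y ↦ funext fun i ↦ ?_
  induction y with
  | h x v =>
    have h1 : (∑ k, mapLocalized W (g ∘ₗ LinearMap.single _ _ k) ∘ₗ LinearMap.proj k)
        (Pi.single j (LocalizedModule.mk x v)) =
          LocalizedModule.mk (g (Pi.single j x)) v := by
      rw [LinearMap.sum_apply, Finset.sum_eq_single j]
      · simp [mapLocalized_mk]
      · intro k _ hk
        simp [Pi.single_eq_of_ne hk]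
      · simp
    have h2 := congrFun (LinearMap.congr_fun hfg (Pi.single j x)) i
    simp only [LinearMap.comp_apply, LinearMap.id_apply] at h2
    simp only [LinearMap.comp_apply, LinearMap.id_apply, LinearMap.coe_single, h1,
      LinearMap.pi_apply, mapLocalized_mk, LinearMap.proj_apply, h2]
    by_cases hij : i = j
    · subst hij; simp
    · rw [Pi.single_eq_of_ne hij, Pi.single_eq_of_ne hij, LocalizedModule.zero_mk]

theorem natCast_le_splittingCapacity_of_local [Module.Finite R S]
    {ι : Type*} (P : ι → Type*) [∀ i, AddCommGroup (P i)] [∀ i, Module Sᵐᵒᵖ (P i)]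
    (hP : ∀ i, Module.FinitePresentation Sᵐᵒᵖ (P i))
    {Q : Type*} [AddCommGroup Q] [Module Sᵐᵒᵖ Q] (e : (M × Q) ≃ₗ[Sᵐᵒᵖ] DirectSum ι P)
    (hN : Module.FinitePresentation Sᵐᵒᵖ N)
    (hY : TopologicalSpace.NoetherianSpace (maxSupport R N))
    (hdim : topologicalKrullDim (maxSupport R N) < ⊤) (t : ℕ)
    (hloc : ∀ m ∈ maxSupport R N, (t : WithBot ℕ∞) + topologicalKrullDim (maxSupport R N)
      ≤ (localSplittingCapacity S M N m : WithBot ℕ∞)) :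
    (t : ℕ∞) ≤ splittingCapacity S M N := by
  have : Module.Finite R N := Module.Finite.trans Sᵐᵒᵖ N
  obtain ⟨d, hd, hld⟩ : ∃ d : ℕ,
      (∀ X : TopologicalSpace.IrreducibleCloseds (maxSupport R N), Order.height X ≤ d) ∧
      ∀ m ∈ maxSupport R N, ((t + d : ℕ) : ℕ∞) ≤ localSplittingCapacity S M N m := by
    cases hD : topologicalKrullDim (maxSupport R N) with
    | bot =>
      have hempty : IsEmpty (TopologicalSpace.IrreducibleCloseds (maxSupport R N)) :=
        Order.krullDim_eq_bot_iff.mp hD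
      -- Dimension `⊥` means that `Y` is empty, and any `d` will do.
      refine ⟨0, fun X ↦ (hempty.false X).elim, fun m hm ↦ (hempty.false
        ⟨closure {⟨m, hm⟩}, isIrreducible_singleton.closure, isClosed_closure⟩).elim⟩
    | coe D =>
      rw [hD] at hdim hloc
      obtain ⟨d, rfl⟩ := ENat.ne_top_iff_exists.mp (WithBot.coe_lt_coe.mp hdim).ne
      refine ⟨d, fun X ↦ ?_, fun m hm ↦ ?_⟩
      · have := Order.height_le_krullDim X
        rw [show Order.krullDim _ = _ from hD] at this
        exact WithBot.coe_le_coe.mp this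
      · have := hloc m hm
        exact_mod_cast this
  obtain ⟨F, G, hFG⟩ := exists_comp_eq_id_of_forall_maxSupport (A := Sᵐᵒᵖ) (M := M) (N := N)
    d hd t fun m hm ↦ by
      obtain ⟨φ, hφ⟩ := natCast_le_splittingCapacity_iff.mp (hld m hm)
      exact exists_comp_eq_smul_of_isSplitSurjective m.asIdeal.primeCompl P hP e hN φ hφ
  exact natCast_le_splittingCapacity_iff.mpr ⟨F, G, hFG⟩

end CapacityBounds

end RightModule

theorem theorem0p5
    {R : Type*} [CommRing R] {S : Type*} [Ring S] [Algebra R S] [Module.Finite R S]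
    -- right `S`-modules `M` and `N`, with the `R`-module structure induced by `R → S`
    {M : Type*} [AddCommGroup M] [Module R M] [Module Sᵐᵒᵖ M] [IsScalarTower R Sᵐᵒᵖ M]
    {N : Type*} [AddCommGroup N] [Module R N] [Module Sᵐᵒᵖ N] [IsScalarTower R Sᵐᵒᵖ N]
    -- `M` is a direct summand of a direct sum of finitely presented right `S`-modules
    {ι : Type*} (P : ι → Type*) [∀ i, AddCommGroup (P i)] [∀ i, Module Sᵐᵒᵖ (P i)]
    (hP : ∀ i, Module.FinitePresentation Sᵐᵒᵖ (P i))
    {Q : Type*} [AddCommGroup Q] [Module Sᵐᵒᵖ Q]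
    (e : (M × Q) ≃ₗ[Sᵐᵒᵖ] DirectSum ι P)
    -- `N` is finitely presented
    (hN : Module.FinitePresentation Sᵐᵒᵖ N)
    (hY : TopologicalSpace.NoetherianSpace (RightModule.maxSupport R N))
    (hdim : topologicalKrullDim (RightModule.maxSupport R N) < ⊤) :
    (∀ t : ℕ, 0 < t →
      (∀ m ∈ RightModule.maxSupport R N,
        (t : WithBot ℕ∞) + topologicalKrullDim (RightModule.maxSupport R N)
          ≤ (RightModule.localSplittingCapacity S M N m : WithBot ℕ∞)) →
      (t : ℕ∞) ≤ RightModule.splittingCapacity S M N) ∧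
    (RightModule.splittingCapacity S M N = ⊤ ↔
      ∀ m ∈ RightModule.maxSupport R N, RightModule.localSplittingCapacity S M N m = ⊤) ∧
    ((∃ n ∈ RightModule.maxSupport R N, RightModule.localSplittingCapacity S M N n < ⊤) →
      -- the minimum `k` of the local capacities and the dimension `d` are natural numbers here
      ∃ k d : ℕ,
        IsLeast (RightModule.localSplittingCapacity S M N '' RightModule.maxSupport R N) (k : ℕ∞) ∧
        topologicalKrullDim (RightModule.maxSupport R N) = (d : WithBot ℕ∞) ∧
        (k : EReal) - (d : EReal)
          ≤ (((RightModule.splittingCapacity S M N : ℕ∞) : ENNReal) : EReal)) := by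
  have key := RightModule.natCast_le_splittingCapacity_of_local P hP e hN hY hdim
  refine ⟨fun t _ h ↦ key t h, ⟨fun h m _ ↦ ?_, fun h ↦ ?_⟩, ?_⟩
  · exact top_le_iff.mp (h ▸ RightModule.splittingCapacity_le_localSplittingCapacity m)
  · refine ENat.eq_top_iff_forall_ge.mpr fun t ↦ key t fun m hm ↦ ?_
    rw [h m hm]
    exact le_top
  · rintro ⟨n, hn, hnlt⟩
    have hmem := csInf_mem (s := RightModule.localSplittingCapacity S M N ''
      RightModule.maxSupport R N) ⟨_, n, hn, rfl⟩
    have hle : ∀ m ∈ RightModule.maxSupport R N,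
        sInf (RightModule.localSplittingCapacity S M N '' RightModule.maxSupport R N) ≤
          RightModule.localSplittingCapacity S M N m :=
      fun m hm ↦ csInf_le (OrderBot.bddBelow _) ⟨m, hm, rfl⟩
    obtain ⟨k, hk⟩ := ENat.ne_top_iff_exists.mp ((hle n hn).trans_lt hnlt).ne
    rw [← hk] at hmem hle
    have : Nonempty (TopologicalSpace.IrreducibleCloseds (RightModule.maxSupport R N)) :=
      ⟨⟨closure {⟨n, hn⟩}, isIrreducible_singleton.closure, isClosed_closure⟩⟩
    obtain ⟨D, hD⟩ := WithBot.ne_bot_iff_exists.mp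
      (Order.krullDim_ne_bot_iff.mpr this :
        topologicalKrullDim (RightModule.maxSupport R N) ≠ ⊥)
    change (D : WithBot ℕ∞) = topologicalKrullDim (RightModule.maxSupport R N) at hD
    rw [← hD] at hdim key
    obtain ⟨d, rfl⟩ := ENat.ne_top_iff_exists.mp (WithBot.coe_lt_coe.mp hdim).ne
    refine ⟨k, d, ⟨hmem, ?_⟩, hD.symm, ?_⟩
    · rintro _ ⟨m, hm, rfl⟩
      exact hle m hm
    -- Here `c` is `k - d` truncated at 0; for `k ≤ d` the bound is trivial.
    · obtain ⟨c, hkc, hc⟩ : ∃ c : ℕ, k ≤ c + d ∧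
          (c : ℕ∞) ≤ RightModule.splittingCapacity S M N := by
        rcases le_total k d with hkd | hdk
        · exact ⟨0, by simpa using hkd, zero_le⟩
        · obtain ⟨c, rfl⟩ := Nat.exists_eq_add_of_le' hdk
          exact ⟨c, le_rfl, key c fun m hm ↦ by exact_mod_cast hle m hm⟩
      have hcast : (c : EReal) ≤
          (((RightModule.splittingCapacity S M N : ℕ∞) : ENNReal) : EReal) := by
        rw [show (c : EReal) = ((c : ENNReal) : EReal) by norm_cast, ← ENat.toENNReal_coe]
        exact EReal.coe_ennreal_le_coe_ennreal_iff.mpr (ENat.toENNReal_le.mpr hc)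
      refine le_trans (EReal.sub_le_of_le_add ?_) hcast
      exact_mod_cast hkc
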